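/- Let $\mathbf C$ be the space of continuous functions $x:[0,1]\to\mathbb R$ with $x(0)=0$, with the sup norm and its Borel $\sigma$-field $\mathfrak C$. For times $u_1,\dots,u_p\in[0,1]$ put $\pi_{u_1,\dots,u_p}(x)=(x(u_1),\dots,x(u_p))$, let $\nu_{u_1,\dots,u_p}$ be the centered $p$-variate normal distribution on $\mathbb R^p$ with covariance matrix $(\min\{u_j,u_r\})_{j,r}$ (possibly singular), and let $\alpha_{u_1,\dots,u_p}$ be the measure on the $\sigma$-field $\pi_{u_1,\dots,u_p}^{-1}(\mathfrak R^p)$, where $\mathfrak R^p$ is the Borel $\sigma$-field of $\mathbb R^p$, given by $\alpha_{u_1,\dots,u_p}(\pi_{u_1,\dots,u_p}^{-1}(B))=\nu_{u_1,\dots,u_p}(B)$. Let $t_1,t_2,\dots$ be a sequence whose set of values $T$ is dense in $[0,1]$. For compact $K\subset\mathbf C$ let $$\varphi(K)=\lim_{n\to\infty}\alpha_{t_1,\dots,t_n}\bigl(\pi_{t_1,\dots,t_n}^{-1}\pi_{t_1,\dots,t_n}(K)\bigr)$$ (the sequence is decreasing), and for $A\in\mathfrak C$ let $$\mu(A)=\sup\{\varphi(K):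 K\subset A,\ K\text{ compact}\}.$$ Then $\mu$ is a probability measure on $\mathfrak C$, and under $\mu$, for every $p$ and arbitrary $u_1,\dots,u_p\in[0,1]$, the random vector $(x(u_1),\dots,x(u_p))$ is centered multivariate normal with covariance matrix $(\min\{u_j,u_r\})_{j,r}$. Hence, under $\mu$, the coordinate process $(x(s))_{0\le s\le 1}$ is a standard Brownian motion on $[0,1]$ (it starts at $0$, has independent increments, $x(s)-x(r)$ is normal with mean $0$ and variance $s-r$ for $r\le s$, and its paths are continuous), and $\mu$ is the Wiener measure, i.e. the one and only probability measure on $\mathfrak C$ under which the coordinate process is a standard Brownian motion. -/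

import Mathlib

open MeasureTheory ProbabilityTheory Filter Topology Set
open scoped unitInterval ENNReal NNReal

noncomputable section

namespace WienerConstruction

/-- The real vector space of continuous functions on `[0,1]` that vanish at `0`. -/
def pathSubmodule : Submodule ℝ C(I, ℝ) where
  carrier := {x | x 0 = 0}
  zero_mem' := by simp
  add_mem' := by
    intro a b ha hb
    simp only [mem_ofPred_eq] at ha hb ⊢
    simp [ha, hb]
  smul_mem' := by
    intro c a ha
    simp only [mem_ofPred_eq] at ha ⊢
    simp [ha]

/-- The path space: continuous functions on `[0,1]` vanishing at `0`, with the sup norm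
(inherited from `C(I, ℝ)`). -/
abbrev PathSpace : Type := pathSubmodule

/-- The path space carries its Borel `σ`-field. -/
instance : MeasurableSpace PathSpace := borel PathSpace

instance : BorelSpace PathSpace := ⟨rfl⟩

/-- The projection `x ↦ (x(u_1), …, x(u_k))`. -/
def proj {k : ℕ} (u : Fin k → I) (x : PathSpace) : EuclideanSpace ℝ (Fin k) :=
  WithLp.toLp 2 fun j => x.1 (u j)

/-- The matrix with entries `min (u_j, u_r)`. -/
def minCov {k : ℕ} (u : Fin k → I) : Matrix (Fin k) (Fin k) ℝ :=
  Matrix.of fun j r => min (u j : ℝ) (u r : ℝ)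

/-- The centered `k`-variate normal distribution with covariance matrix `min (u_j, u_r)`. -/
def gauss {k : ℕ} (u : Fin k → I) : Measure (EuclideanSpace ℝ (Fin k)) :=
  multivariateGaussian 0 (minCov u)

instance {k : ℕ} (u : Fin k → I) : IsGaussian (gauss u) := by
  unfold gauss; infer_instance

/-- The matrix `min (u_j, u_r)` is a genuine covariance matrix. -/
lemma posSemidef_minCov {k : ℕ} (u : Fin k → I) : (minCov u).PosSemidef := by
  have : minCov u = .of fun s t ↦ volume.real (Icc 0 (u s : ℝ) ∩ Icc 0 (u t : ℝ)) := by
    ext s t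
    have h : 0 ≤ min (u s : ℝ) (u t : ℝ) := le_min (u s).2.1 (u t).2.1
    simp [Icc_inter_Icc, minCov, h]
  rw [this]
  exact posSemidef_matrix_measure_inter (fun _ ↦ measurableSet_Icc)
    (fun _ ↦ isCompact_Icc.measure_ne_top)

lemma continuous_proj {k : ℕ} (u : Fin k → I) : Continuous (proj u) := by
  unfold proj
  refine (PiLp.continuous_toLp 2 _).comp (continuous_pi fun j => ?_)
  exact (continuous_eval_const (u j)).comp continuous_subtype_val

/-- The values at times `u` of a path can be prescribed, as long as equal times get equal values
and time `0` gets the value `0`. -/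
lemma mem_range_proj {k : ℕ} (u : Fin k → I) (v : EuclideanSpace ℝ (Fin k))
    (h : ∀ i j, u i = u j → v i = v j) (h0 : ∀ i, u i = 0 → v i = 0) :
    v ∈ range (proj u) := by
  classical
  let r : I → ℝ := fun τ => if hτ : ∃ i, u i = τ then v hτ.choose else 0
  have hr : ∀ i, r (u i) = v i := by
    intro i
    have hτ : ∃ j, u j = u i := ⟨i, rfl⟩
    simp only [r, dif_pos hτ]
    exact h _ _ hτ.choose_spec
  have hr0 : r 0 = 0 := by
    by_cases hτ : ∃ j, u j = 0
    · simp only [r, dif_pos hτ]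
      exact h0 _ hτ.choose_spec
    · simp only [r, dif_neg hτ]
  let s : Finset I := insert 0 (Finset.univ.image u)
  let q : Polynomial ℝ := Lagrange.interpolate s (fun τ => (τ : ℝ)) r
  have hq : ∀ τ ∈ s, q.eval (τ : ℝ) = r τ := fun τ hτ =>
    Lagrange.eval_interpolate_at_node r (fun a _ b _ hab => Subtype.ext hab) hτ
  let x : C(I, ℝ) := ⟨fun τ => q.eval (τ : ℝ), by fun_prop⟩
  have hx : x ∈ pathSubmodule := by
    have := hq 0 (by simp [s])
    rw [hr0] at this
    exact this
  refine ⟨⟨x, hx⟩, ?_⟩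
  ext i
  have := hq (u i) (by simp [s])
  rw [hr] at this
  exact this

/-- The normal distribution `gauss u` is carried by the range of the projection `proj u`. -/
lemma ae_mem_range_proj {k : ℕ} (u : Fin k → I) : ∀ᵐ v ∂(gauss u), v ∈ range (proj u) := by
  have hS := posSemidef_minCov u
  have hL : ∀ i, MemLp (fun v : EuclideanSpace ℝ (Fin k) => v i) 2 (gauss u) := fun i =>
    (IsGaussian.memLp_two_id (μ := gauss u)).continuousLinearMap_comp
      (EuclideanSpace.proj (𝕜 := ℝ) i)
  have hcov : ∀ i j, cov[fun v : EuclideanSpace ℝ (Fin k) => v i, fun v => v j; gauss u]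
      = min (u i : ℝ) (u j : ℝ) := fun i j => covariance_eval_multivariateGaussian hS i j
  have hmean : ∀ i, ∫ v : EuclideanSpace ℝ (Fin k), v i ∂(gauss u) = 0 := by
    intro i
    have := (measurePreserving_eval_multivariateGaussian (μ := 0) hS (i := i)).hasLaw.integral_eq
    simpa [gauss] using this
  have hA : ∀ i j, ∀ᵐ v ∂(gauss u), u i = u j → v i = v j := by
    intro i j
    by_cases hij : u i = u j
    · have hd := (hL i).sub (hL j)
      have hvar : Var[(fun v : EuclideanSpace ℝ (Fin k) => v i) - (fun v => v j); gauss u] = 0 := by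
        rw [variance_sub (hL i) (hL j), ← covariance_self (hL i).aemeasurable,
          ← covariance_self (hL j).aemeasurable, hcov, hcov, hcov, hij]
        simp; ring
      have := ae_eq_integral_of_variance_eq_zero hd hvar
      have hm : ∫ v : EuclideanSpace ℝ (Fin k),
          ((fun v : EuclideanSpace ℝ (Fin k) => v i) - (fun v : EuclideanSpace ℝ (Fin k) => v j)) v ∂(gauss u) = 0 := by
        rw [integral_sub' ((hL i).integrable (by norm_num)) ((hL j).integrable (by norm_num)),
          hmean, hmean, sub_zero]
      filter_upwards [this] with v hv _
      rw [hm] at hv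
      simpa [sub_eq_zero] using hv
    · exact ae_of_all _ fun v hv => absurd hv hij
  have hB : ∀ i, ∀ᵐ v ∂(gauss u), u i = 0 → v i = 0 := by
    intro i
    by_cases hi : u i = 0
    · have hvar : Var[(fun v : EuclideanSpace ℝ (Fin k) => v i); gauss u] = 0 := by
        rw [← covariance_self (hL i).aemeasurable, hcov, hi]
        simp
      have := ae_eq_integral_of_variance_eq_zero (hL i) hvar
      filter_upwards [this] with v hv _
      rw [hv, hmean]
    · exact ae_of_all _ fun v hv => absurd hv hi
  have hA' := ae_all_iff.2 fun i => ae_all_iff.2 (hA i)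
  have hB' := ae_all_iff.2 hB
  filter_upwards [hA', hB'] with v h1 h2
  exact mem_range_proj u v h1 h2

/-- The sub-`σ`-field of cylinder sets over the times `u`. -/
abbrev cylField {k : ℕ} (u : Fin k → I) : MeasurableSpace PathSpace :=
  MeasurableSpace.comap (proj u) inferInstance

lemma image_preimage_ae {k : ℕ} (u : Fin k → I) (B : Set (EuclideanSpace ℝ (Fin k))) :
    (proj u '' (proj u ⁻¹' B) : Set _) =ᵐ[gauss u] B := by
  rw [image_preimage_eq_inter_range]
  filter_upwards [ae_mem_range_proj u] with v hv
  apply propext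
  exact ⟨fun h => h.1, fun h => ⟨h, hv⟩⟩

/-- The measure generated on the cylinder field over the times `u` by the normal distribution
`gauss u` through the projection: it sends `proj u ⁻¹' B` to `gauss u B`
(see `cylMeasure_preimage`). -/
def cylMeasure {k : ℕ} (u : Fin k → I) : @Measure PathSpace (cylField u) :=
  @Measure.ofMeasurable PathSpace (cylField u) (fun A _ => gauss u (proj u '' A))
    (by simp)
    (by
      intro A hA hd
      have hN : ∀ i, NullMeasurableSet (proj u '' A i) (gauss u) := by
        intro i
        obtain ⟨B, hB, hBA⟩ := hA i
        rw [← hBA]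
        exact hB.nullMeasurableSet.congr (image_preimage_ae u B).symm
      rw [image_iUnion]
      refine measure_iUnion₀ (fun i j hij => Disjoint.aedisjoint ?_) hN
      obtain ⟨B, hB, hBA⟩ := hA i
      rw [Set.disjoint_left]
      rintro _ ⟨x, hx, rfl⟩ ⟨y, hy, hxy⟩
      have : y ∈ A i := by
        rw [← hBA] at hx ⊢
        rw [mem_preimage] at hx ⊢
        rwa [hxy]
      exact Set.disjoint_left.1 (hd hij) this hy)

lemma cylMeasure_preimage {k : ℕ} (u : Fin k → I) {B : Set (EuclideanSpace ℝ (Fin k))}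
    (hB : MeasurableSet B) : cylMeasure u (proj u ⁻¹' B) = gauss u B := by
  have hm : @MeasurableSet _ (cylField u) (proj u ⁻¹' B) := ⟨B, hB, rfl⟩
  unfold cylMeasure
  rw [@Measure.ofMeasurable_apply _ (cylField u) _ _ _ _ hm]
  exact measure_congr (image_preimage_ae u B)

/-- The first `n` times `(t_1, …, t_n)` of a sequence of times (indexed from `0` in Lean). -/
def firstTimes (t : ℕ → I) (n : ℕ) : Fin n → I := fun i => t i

/-- `φ(K) = lim_n α_{t_1,…,t_n} (π_{t_1,…,t_n}⁻¹ π_{t_1,…,t_n} K)`, used for compact `K` only;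
the limit exists by `tendsto_phi`. -/
def phi (t : ℕ → I) (K : Set PathSpace) : ℝ≥0∞ :=
  limUnder atTop fun n : ℕ => cylMeasure (firstTimes t n)
    (proj (firstTimes t n) ⁻¹' (proj (firstTimes t n) '' K))

/-- `μ(A) = sup {φ(K) : K ⊆ A compact}`. -/
def mu (t : ℕ → I) (A : Set PathSpace) : ℝ≥0∞ :=
  ⨆ (K : Set PathSpace) (_ : IsCompact K) (_ : K ⊆ A), phi t K

/-- The normal distributions are consistent: selecting times `u ∘ f` gives the marginal. -/
lemma map_gauss {j k : ℕ} (u : Fin k → I) (f : Fin j → Fin k) :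
    (gauss u).map (fun v => (WithLp.toLp 2 fun i => v (f i) : EuclideanSpace ℝ (Fin j)))
      = gauss (u ∘ f) := by
  have hL : ∀ i, MemLp (fun v : EuclideanSpace ℝ (Fin k) => v i) 2 (gauss u) := fun i =>
    (IsGaussian.memLp_two_id (μ := gauss u)).continuousLinearMap_comp
      (EuclideanSpace.proj (𝕜 := ℝ) i)
  let L : EuclideanSpace ℝ (Fin k) →L[ℝ] EuclideanSpace ℝ (Fin j) :=
    LinearMap.toContinuousLinearMap
      { toFun := fun v => WithLp.toLp 2 fun i => v (f i)
        map_add' := fun _ _ => rfl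
        map_smul' := fun _ _ => rfl }
  change (gauss u).map L = _
  apply IsGaussian.ext
  · simp only [id_eq, gauss, integral_id_multivariateGaussian]
    rw [ContinuousLinearMap.integral_id_map, integral_id_multivariateGaussian, map_zero]
    exact IsGaussian.integrable_id
  · rw [← ContinuousLinearMap.toBilinForm_inj]
    refine LinearMap.BilinForm.ext_basis (EuclideanSpace.basisFun (Fin j) ℝ).toBasis fun a b ↦ ?_
    rw [ContinuousLinearMap.toBilinForm_apply, ContinuousLinearMap.toBilinForm_apply,
      covarianceBilin_apply_eq_cov, covariance_map]
    · have (i : Fin j) : (fun v ↦ inner ℝ ((EuclideanSpace.basisFun (Fin j) ℝ).toBasis i) v) ∘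
          L = fun v ↦ v (f i) := by ext v; simp [PiLp.inner_apply]; rfl
      simp_rw [this, gauss, covariance_eval_multivariateGaussian (posSemidef_minCov u),
        covarianceBilin_multivariateGaussian (posSemidef_minCov (u ∘ f))]
      simp [minCov]
    any_goals exact Measurable.aestronglyMeasurable (by fun_prop)
    · fun_prop
    · exact IsGaussian.memLp_two_id

/-- The limit in the definition of `phi` exists. -/
lemma tendsto_phi (t : ℕ → I) {K : Set PathSpace} (hK : IsCompact K) :
    Tendsto (fun n : ℕ => cylMeasure (firstTimes t n)
      (proj (firstTimes t n) ⁻¹' (proj (firstTimes t n) '' K))) atTop (𝓝 (phi t K)) := by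
  have hc : ∀ n, MeasurableSet (proj (firstTimes t n) '' K) := fun n =>
    (hK.image (continuous_proj _)).measurableSet
  refine tendsto_nhds_limUnder ⟨_, tendsto_atTop_iInf (antitone_nat_of_succ_le fun n => ?_)⟩
  rw [cylMeasure_preimage _ (hc n), cylMeasure_preimage _ (hc (n + 1))]
  have hm := map_gauss (firstTimes t (n + 1)) (Fin.castSucc : Fin n → Fin (n + 1))
  have he : firstTimes t (n + 1) ∘ Fin.castSucc = firstTimes t n := by
    ext i; simp [firstTimes]
  rw [he] at hm
  rw [← hm, Measure.map_apply (by fun_prop) (hc n)]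
  refine measure_mono ?_
  rintro _ ⟨x, hx, rfl⟩
  exact ⟨x, hx, rfl⟩

/-- Standard Brownian motion with time set `[0,1]`: it starts at `0`, has independent increments,
the increment over `[r, s]` is normal with mean `0` and variance `s - r`, and almost all its paths
are continuous. -/
structure IsBrownianMotion {Ω : Type*} [MeasurableSpace Ω] (X : I → Ω → ℝ) (P : Measure Ω) :
    Prop where
  start_zero : ∀ᵐ ω ∂P, X 0 ω = 0
  indep_increments : HasIndepIncrements X P
  gaussian_increments : ∀ r s : I, r ≤ s →
    HasLaw (fun ω => X s ω - X r ω) (gaussianReal 0 ((s : ℝ) - (r : ℝ)).toNNReal) P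
  continuous_paths : ∀ᵐ ω ∂P, Continuous fun s : I => X s ω

/-- The coordinate process on the path space. -/
def coordinate (s : I) (x : PathSpace) : ℝ := x.1 s

/-- A measure on the path space is the Wiener measure if it is a probability measure under which
the coordinate process is a standard Brownian motion. -/
structure IsWienerMeasure (P : Measure PathSpace) : Prop where
  isProbabilityMeasure : IsProbabilityMeasure P
  isBrownianMotion : IsBrownianMotion coordinate P

end WienerConstruction

end

noncomputable section

namespace WienerConstruction

/-! No additivity of `mu` is proved directly: a Brownian law `P` is built independently and then
identified with `mu`. If a probability measure has the laws `gauss u` as finite dimensional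
distributions, it agrees with `phi` on compact sets, since a compact `K` is the decreasing
intersection of its cylinder hulls along the dense times (`iInter_preimage_image_proj`). Inner
regularity then makes it equal to `mu` on Borel sets (`measure_eq_mu`). This also gives uniqueness,
because every Wiener measure has these distributions (`IsWienerMeasure.map_proj`).

Existence comes from the Lévy-Ciesielski series with independent standard normal coefficients.
Fourth moments give almost sure uniform convergence (`ae_tendsto_levySum`). The covariance of the
limit is `min s t` because the bridge covariance is self-similar under halving the interval
(`bridgeCov_eq`), and iterating this expands it in products of Schauder functions
(`tendsto_sum_tent`). Characteristic functions pass this to the limit (`map_proj_levy`). -/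

lemma isClosed_pathSubmodule : IsClosed (pathSubmodule : Set C(I, ℝ)) :=
  isClosed_eq (continuous_eval_const (0 : I)) continuous_const

/-- Together with second countability, this makes finite Borel measures on the path space inner
regular for compact sets. -/
instance : CompleteSpace PathSpace := isClosed_pathSubmodule.completeSpace_coe

instance : SecondCountableTopology PathSpace :=
  inferInstanceAs (SecondCountableTopology {x : C(I, ℝ) // x ∈ pathSubmodule})

lemma proj_apply {k : ℕ} (u : Fin k → I) (x : PathSpace) (j : Fin k) :
    proj u x j = x.1 (u j) := rfl

lemma measurable_proj {k : ℕ} (u : Fin k → I) : Measurable (proj u) :=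
  (continuous_proj u).measurable

lemma continuous_coordinate (s : I) : Continuous (coordinate s) :=
  (continuous_eval_const s).comp continuous_subtype_val

lemma coordinate_zero (x : PathSpace) : coordinate 0 x = 0 := x.2

/-! ### Identification with `phi` and `mu` -/

lemma antitone_preimage_image_proj (t : ℕ → I) (K : Set PathSpace) :
    Antitone fun n => proj (firstTimes t n) ⁻¹' (proj (firstTimes t n) '' K) := by
  refine antitone_nat_of_succ_le fun n => ?_
  rintro y ⟨x, hx, hxy⟩
  refine ⟨x, hx, ?_⟩
  ext i
  exact congrArg (fun v => v i.castSucc) hxy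

/-- A compact set of paths is determined by its projections along a dense sequence of times. -/
lemma iInter_preimage_image_proj {t : ℕ → I} (ht : DenseRange t) {K : Set PathSpace}
    (hK : IsCompact K) :
    ⋂ n, proj (firstTimes t n) ⁻¹' (proj (firstTimes t n) '' K) = K := by
  refine subset_antisymm (fun y hy => ?_) (subset_iInter fun n => subset_preimage_image _ _)
  have hcl : ∀ n, IsClosed (K ∩ {x | proj (firstTimes t n) x = proj (firstTimes t n) y}) :=
    fun n => hK.isClosed.inter (isClosed_eq (continuous_proj _) continuous_const)
  -- Cantor's intersection theorem: the paths of `K` that agree with `y` at the first `n` times form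
  -- nested nonempty compact sets. A common element agrees with `y` on a dense set, hence
  -- everywhere.
  obtain ⟨x, hx⟩ := IsCompact.nonempty_iInter_of_sequence_nonempty_isCompact_isClosed
    (fun n => K ∩ {x | proj (firstTimes t n) x = proj (firstTimes t n) y})
    (fun n x hx => ⟨hx.1, by
      ext i
      exact congrArg (fun v => v i.castSucc) hx.2⟩)
    (fun n => by
      obtain ⟨x, hx, hxy⟩ := mem_iInter.1 hy n
      exact ⟨x, hx, hxy⟩)
    (hK.of_isClosed_subset (hcl 0) inter_subset_left) hcl
  rw [mem_iInter] at hx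
  have hxy : x = y := by
    refine Subtype.ext (ContinuousMap.coe_injective ?_)
    refine ht.equalizer x.1.continuous y.1.continuous (funext fun n => ?_)
    exact congrArg (fun v => v (Fin.last n)) (hx (n + 1)).2
  exact hxy ▸ (hx 0).1

/-- A probability measure with the right finite dimensional distributions agrees with `phi` on
compact sets. -/
lemma measure_eq_phi {t : ℕ → I} (ht : DenseRange t) {P : Measure PathSpace}
    [IsProbabilityMeasure P] (hP : ∀ (p : ℕ) (u : Fin p → I), P.map (proj u) = gauss u)
    {K : Set PathSpace} (hK : IsCompact K) : P K = phi t K := by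
  have hc : ∀ n, MeasurableSet (proj (firstTimes t n) '' K) := fun n =>
    (hK.image (continuous_proj _)).measurableSet
  have h := tendsto_measure_iInter_atTop (μ := P)
    (fun n => (measurable_proj (firstTimes t n) (hc n)).nullMeasurableSet)
    (antitone_preimage_image_proj t K) ⟨0, measure_ne_top _ _⟩
  rw [iInter_preimage_image_proj ht hK] at h
  refine tendsto_nhds_unique h ((tendsto_phi t hK).congr fun n => ?_)
  rw [cylMeasure_preimage _ (hc n), ← hP, Measure.map_apply (measurable_proj _) (hc n)]
  rfl

/-- By inner regularity, the values on compact sets, already known to be `phi t K`, determine the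
measure. Since `mu` does not mention `P`, this serves for both existence and uniqueness. -/
lemma measure_eq_mu {t : ℕ → I} (ht : DenseRange t) {P : Measure PathSpace}
    [IsProbabilityMeasure P] (hP : ∀ (p : ℕ) (u : Fin p → I), P.map (proj u) = gauss u)
    {A : Set PathSpace} (hA : MeasurableSet A) : P A = mu t A := by
  rw [hA.measure_eq_iSup_isCompact_of_ne_top (measure_ne_top P A), mu]
  refine iSup_congr fun K => ?_
  rw [iSup_comm]
  exact iSup_congr fun hK => iSup_congr fun _ => measure_eq_phi ht hP hK

/-! ### Brownian motion and its finite dimensional distributions -/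

/-- The law of a random vector `proj u` under a measure that makes the coordinate process a centered
Gaussian process with covariance `min`. -/
lemma map_proj_of_isGaussianProcess {P : Measure PathSpace}
    (hG : IsGaussianProcess coordinate P) (hm : ∀ s, ∫ x, coordinate s x ∂P = 0)
    (hc : ∀ r s : I, r ≤ s → cov[coordinate r, coordinate s; P] = r)
    {p : ℕ} (u : Fin p → I) : P.map (proj u) = gauss u := by
  have := hG.isProbabilityMeasure
  have hproj : HasGaussianLaw (proj u) P := by
    classical
    -- The times in `u` may repeat, whereas a Gaussian process is tested on finite sets of times;
    -- `L` duplicates coordinates as needed.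
    let L : (Finset.univ.image u → ℝ) →L[ℝ] EuclideanSpace ℝ (Fin p) :=
      LinearMap.toContinuousLinearMap
        { toFun := fun v => WithLp.toLp 2 fun i => v ⟨u i, by simp⟩
          map_add' := fun _ _ => rfl
          map_smul' := fun _ _ => rfl }
    exact (hG.hasGaussianLaw (Finset.univ.image u)).map L
  have hcov : ∀ i j, cov[coordinate (u i), coordinate (u j); P] = minCov u i j := by
    intro i j
    rcases le_total (u i) (u j) with h | h
    · rw [hc _ _ h, minCov, Matrix.of_apply, min_eq_left (by exact_mod_cast h)]
    · rw [covariance_comm, hc _ _ h, minCov, Matrix.of_apply, min_eq_right (by exact_mod_cast h)]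
  have hL : ∀ s, MemLp (coordinate s) 2 P := fun s => (hG.hasGaussianLaw_eval s).memLp_two
  have hgm := hproj.isGaussian_map
  refine IsGaussian.ext ?_ ?_
  · simp only [id_eq, gauss, integral_id_multivariateGaussian]
    rw [integral_map (measurable_proj u).aemeasurable (by fun_prop)]
    ext i
    have := (EuclideanSpace.proj (𝕜 := ℝ) i).integral_comp_comm hproj.integrable
    simp only [PiLp.proj_apply] at this
    rw [← this]
    exact hm (u i)
  · rw [← ContinuousLinearMap.toBilinForm_inj]
    refine LinearMap.BilinForm.ext_basis (EuclideanSpace.basisFun (Fin p) ℝ).toBasis fun a b ↦ ?_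
    rw [ContinuousLinearMap.toBilinForm_apply, ContinuousLinearMap.toBilinForm_apply,
      covarianceBilin_apply_eq_cov, covariance_map, gauss,
      covarianceBilin_multivariateGaussian (posSemidef_minCov u)]
    · have (i : Fin p) : (fun v ↦ inner ℝ ((EuclideanSpace.basisFun (Fin p) ℝ).toBasis i) v) ∘
          proj u = coordinate (u i) := by
        ext v
        simp [PiLp.inner_apply]
        rfl
      simp_rw [this, hcov]
      simp
    any_goals exact Measurable.aestronglyMeasurable (by fun_prop)
    · exact (measurable_proj u).aemeasurable
    · exact IsGaussian.memLp_two_id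

/-- Under a Wiener measure the finite dimensional distributions are the expected ones. -/
lemma IsWienerMeasure.map_proj {Q : Measure PathSpace} (hQ : IsWienerMeasure Q) {p : ℕ}
    (u : Fin p → I) : Q.map (proj u) = gauss u := by
  have := hQ.isProbabilityMeasure
  have hB := hQ.isBrownianMotion
  have h0 : ∀ᵐ x ∂Q, coordinate (⊥ : I) x = 0 := hB.start_zero
  have law : ∀ s : I, HasLaw (coordinate s) (gaussianReal 0 (s : ℝ).toNNReal) Q := by
    intro s
    have := hB.gaussian_increments 0 s s.2.1
    simpa [coordinate_zero] using this
  have hL : ∀ s, MemLp (coordinate s) 2 Q := fun s => (law s).hasGaussianLaw.memLp_two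
  refine map_proj_of_isGaussianProcess ?_ (fun s => ?_) (fun r s hrs => ?_) u
  · exact hB.indep_increments.isGaussianProcess (fun t => (law t).hasGaussianLaw) h0
  · rw [(law s).integral_eq, integral_id_gaussianReal]
  · have h1 := hB.indep_increments.indepFun_eval_sub bot_le hrs h0
    -- The increment is independent of `coordinate r`, so the covariance reduces to the variance at
    -- time `r`.
    have h2 : coordinate s = coordinate s - coordinate r + coordinate r := by simp
    rw [h2, covariance_add_right (hL r) ((hL s).sub (hL r)) (hL r),
      h1.covariance_eq_zero (hL r) ((hL s).sub (hL r)), covariance_self (hL r).aemeasurable,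
      (law r).variance_eq, variance_id_gaussianReal, zero_add, Real.coe_toNNReal _ r.2.1]

/-- A measure with the right finite dimensional distributions is a Wiener measure. -/
lemma isBrownianMotion_coordinate {P : Measure PathSpace} [IsProbabilityMeasure P]
    (hP : ∀ (p : ℕ) (u : Fin p → I), P.map (proj u) = gauss u) :
    IsBrownianMotion coordinate P := by
  have hlaw : ∀ {p : ℕ} (u : Fin p → I), HasLaw (proj u) (gauss u) P := fun u =>
    ⟨(measurable_proj u).aemeasurable, hP _ u⟩
  have hG : IsGaussianProcess coordinate P := by
    refine ⟨fun J => ?_⟩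
    let e := J.equivFin
    let L : EuclideanSpace ℝ (Fin J.card) →L[ℝ] (J → ℝ) :=
      LinearMap.toContinuousLinearMap
        { toFun := fun v j => v (e j)
          map_add' := fun _ _ => rfl
          map_smul' := fun _ _ => rfl }
    have h := (hlaw fun i => (e.symm i : I)).hasGaussianLaw.map L
    have heq : (fun x => J.restrict (coordinate · x)) = L ∘ proj fun i => (e.symm i : I) := by
      funext x j
      change coordinate j x = coordinate (e.symm (e j)) x
      rw [Equiv.symm_apply_apply]
    rw [heq]
    exact h
  have hL : ∀ s, MemLp (coordinate s) 2 P := fun s => (hG.hasGaussianLaw_eval s).memLp_two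
  have hm : ∀ s, ∫ x, coordinate s x ∂P = 0 := by
    intro s
    have h := ((measurePreserving_eval_multivariateGaussian (μ := 0) (i := 0)
      (posSemidef_minCov ![s])).hasLaw.comp (hlaw ![s])).integral_eq
    rw [integral_id_gaussianReal] at h
    exact h
  have hc : ∀ r s, cov[coordinate r, coordinate s; P] = min (r : ℝ) s := by
    intro r s
    have h := (hlaw ![r, s]).covariance_fun_comp (f := fun v => v 0) (g := fun v => v 1)
      (by fun_prop) (by fun_prop)
    rw [gauss, covariance_eval_multivariateGaussian (posSemidef_minCov ![r, s]) 0 1] at h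
    exact h
  refine ⟨ae_of_all _ coordinate_zero, ?_, fun r s hrs => ?_, ae_of_all _ fun x => x.1.continuous⟩
  -- Jointly Gaussian increments are independent as soon as they are uncorrelated.
  · refine fun n t ht => hG.hasGaussianLaw_increments.iIndepFun_of_covariance_eq_zero
      fun i j hij => ?_
    rw [covariance_fun_sub_fun_sub (hL _) (hL _) (hL _) (hL _)]
    simp_rw [hc]
    wlog h : i < j generalizing i j
    · have := this j i hij.symm (by grind)
      simp_rw [min_comm (t j.succ : ℝ), min_comm (t j.castSucc : ℝ)] at this
      linarith
    -- The interval `i` lies to the left of `j`, so each minimum is an endpoint of interval `i` and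
    -- the four terms cancel.
    have h1 : (t i.succ : ℝ) ≤ t j.castSucc := ht (Fin.le_castSucc_iff.mpr (Fin.strictMono_succ h))
    have h2 : (t i.castSucc : ℝ) ≤ t i.succ := ht (Fin.castSucc_le_succ i)
    have h3 : (t j.castSucc : ℝ) ≤ t j.succ := ht (Fin.castSucc_le_succ j)
    rw [min_eq_left, min_eq_left, min_eq_left, min_eq_left] <;> linarith
  · refine ⟨((continuous_coordinate s).sub (continuous_coordinate r)).aemeasurable, ?_⟩
    have h := (hG.hasGaussianLaw_fun_sub (s := s) (t := r)).map_eq_gaussianReal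
    have hrs' : (r : ℝ) ≤ s := hrs
    rw [h, integral_sub ((hL s).integrable (by norm_num)) ((hL r).integrable (by norm_num)), hm, hm,
      sub_zero, variance_fun_sub (hL s) (hL r), ← covariance_self (hL s).aemeasurable,
      ← covariance_self (hL r).aemeasurable, hc, hc, hc, min_self, min_self, min_eq_right hrs']
    congr 2
    ring

/-! ### Dyadic expansion of the bridge covariance -/

/-- The tent function supported on `[0,1]`. -/
def tent (x : ℝ) : ℝ := max 0 (min x (1 - x))

lemma continuous_tent : Continuous tent := by unfold tent; fun_prop

lemma tent_nonneg (x : ℝ) : 0 ≤ tent x := le_max_left _ _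

lemma tent_le_one (x : ℝ) : tent x ≤ 1 := by unfold tent; grind

lemma tent_of_notMem {x : ℝ} (hx : x ∉ Ioo 0 1) : tent x = 0 := by
  unfold tent; grind

/-- The covariance function of the Brownian bridge, extended by zero outside of the unit square. -/
def bridgeCov (x y : ℝ) : ℝ := max 0 (min x y) * max 0 (1 - max x y)

lemma bridgeCov_of_notMem {x y : ℝ} (hx : x ∉ Ioo 0 1) : bridgeCov x y = 0 := by
  unfold bridgeCov; grind

lemma abs_bridgeCov_le_one (x y : ℝ) : |bridgeCov x y| ≤ 1 := by
  unfold bridgeCov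
  have h1 : 0 ≤ max 0 (min x y) := le_max_left _ _
  have h2 : 0 ≤ max 0 (1 - max x y) := le_max_left _ _
  rw [abs_of_nonneg (mul_nonneg h1 h2)]
  by_cases hx : x ∈ Ioo (0 : ℝ) 1
  · exact mul_le_one₀ (by grind) h2 (by grind)
  · have := bridgeCov_of_notMem (y := y) hx
    unfold bridgeCov at this
    rw [this]; exact zero_le_one

/-- The self-similarity of the Brownian bridge covariance. -/
lemma bridgeCov_eq (x y : ℝ) : bridgeCov x y =
    tent x * tent y + 2⁻¹ * (bridgeCov (2 * x) (2 * y) + bridgeCov (2 * x - 1) (2 * y - 1)) := by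
  wlog h : x ≤ y generalizing x y
  · have := this y x (le_of_not_ge h)
    simp only [bridgeCov, min_comm y, max_comm y, min_comm (2 * y), max_comm (2 * y),
      min_comm (2 * y - 1), max_comm (2 * y - 1), mul_comm (tent y)] at this ⊢
    exact this
  simp only [bridgeCov, tent]
  rw [min_eq_left h, max_eq_right h, min_eq_left (by linarith : 2 * x ≤ 2 * y),
    max_eq_right (by linarith : 2 * x ≤ 2 * y), min_eq_left (by linarith : 2 * x - 1 ≤ 2 * y - 1),
    max_eq_right (by linarith : 2 * x - 1 ≤ 2 * y - 1)]
  rcases le_total x 0 with hx | hx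
  · simp [hx, (by linarith : 2 * x ≤ 0), (by linarith : 2 * x ≤ 1)]
  rcases le_total 1 y with hy | hy
  · simp [hy, (by linarith : 1 ≤ 2 * y), (by linarith : 1 ≤ 2 * y - 1)]
  rw [max_eq_right hx, max_eq_right (by linarith : 0 ≤ 1 - y)]
  -- The first rescaled bridge survives when both points are at most `1/2`, the second when both are
  -- at least `1/2`, neither when `1/2` separates them.
  rcases le_total x 2⁻¹ with hx2 | hx2
  · rw [min_eq_left (by linarith : x ≤ 1 - x), max_eq_right hx,
      max_eq_left (by linarith : 2 * x - 1 ≤ 0), max_eq_right (by linarith : 0 ≤ 2 * x)]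
    rcases le_total y 2⁻¹ with hy2 | hy2
    · rw [min_eq_left (by linarith : y ≤ 1 - y), max_eq_right (by linarith : 0 ≤ y),
        max_eq_right (by linarith : 0 ≤ 1 - 2 * y)]
      ring
    · rw [min_eq_right (by linarith : 1 - y ≤ y), max_eq_right (by linarith : 0 ≤ 1 - y),
        max_eq_left (by linarith : 1 - 2 * y ≤ 0)]
      ring
  · rw [min_eq_right (by linarith : 1 - x ≤ x), min_eq_right (by linarith : 1 - y ≤ y),
      max_eq_right (by linarith : 0 ≤ 1 - x), max_eq_right (by linarith : 0 ≤ 1 - y),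
      max_eq_left (by linarith : 1 - 2 * y ≤ 0), max_eq_right (by linarith : 0 ≤ 2 * x - 1),
      max_eq_right (by linarith : 0 ≤ 1 - (2 * y - 1))]
    ring

lemma sum_range_two_mul (f : ℕ → ℝ) (N : ℕ) :
    ∑ k ∈ Finset.range (2 * N), f k = ∑ k ∈ Finset.range N, (f (2 * k) + f (2 * k + 1)) := by
  induction N with
  | zero => simp
  | succ N ih => rw [mul_add_one, Finset.sum_range_succ, Finset.sum_range_succ,
      Finset.sum_range_succ, ih, add_assoc]

/-- Iterate `bridgeCov_eq`: at each level, the remainder on dyadic interval `k` splits into those on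
its halves `2k` and `2k + 1`. -/
lemma bridgeCov_eq_sum (s t : ℝ) (n : ℕ) : bridgeCov s t =
    ∑ m ∈ Finset.range n, (2⁻¹ : ℝ) ^ m *
      ∑ k ∈ Finset.range (2 ^ m), tent (2 ^ m * s - k) * tent (2 ^ m * t - k) +
    2⁻¹ ^ n * ∑ k ∈ Finset.range (2 ^ n), bridgeCov (2 ^ n * s - k) (2 ^ n * t - k) := by
  induction n with
  | zero => simp
  | succ n ih =>
    rw [ih, Finset.sum_range_succ, add_assoc, pow_succ' 2 n, sum_range_two_mul, pow_succ (2⁻¹ : ℝ) n,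
      mul_assoc, ← mul_add]
    congr 2
    rw [Finset.mul_sum, ← Finset.sum_add_distrib]
    refine Finset.sum_congr rfl fun k _ => ?_
    rw [bridgeCov_eq]
    push_cast
    ring_nf

/-- A sum of terms with disjoint supports is bounded by a common bound of the terms. -/
lemma abs_sum_le_of_support {f : ℕ → ℝ} {x B : ℝ} (s : Finset ℕ) (hB : 0 ≤ B)
    (hf : ∀ k : ℕ, x - k ∉ Ioo (0 : ℝ) 1 → f k = 0) (hfB : ∀ k ∈ s, |f k| ≤ B) :
    |∑ k ∈ s, f k| ≤ B := by
  by_cases h : ∃ k ∈ s, f k ≠ 0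
  · obtain ⟨k, hk, hk0⟩ := h
    rw [Finset.sum_eq_single_of_mem k hk]
    · exact hfB k hk
    · intro l _ hlk
      by_contra hl0
      have h1 := not_imp_comm.1 (hf k) hk0
      have h2 := not_imp_comm.1 (hf l) hl0
      refine hlk (le_antisymm ?_ ?_)
      · have : (l : ℝ) < k + 1 := by linarith [h1.2, h2.1]
        exact Nat.lt_succ_iff.1 (by exact_mod_cast this)
      · have : (k : ℝ) < l + 1 := by linarith [h1.1, h2.2]
        exact Nat.lt_succ_iff.1 (by exact_mod_cast this)
  · push Not at h
    rw [Finset.sum_eq_zero h, abs_zero]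
    exact hB

/-- The rescaled bridges in the remainder of `bridgeCov_eq_sum` have disjoint supports and are
bounded by `1`, so the remainder is at most `2⁻¹ ^ n`. -/
lemma tendsto_sum_tent (s t : ℝ) :
    Tendsto (fun n => ∑ m ∈ Finset.range n, (2⁻¹ : ℝ) ^ m *
      ∑ k ∈ Finset.range (2 ^ m), tent (2 ^ m * s - k) * tent (2 ^ m * t - k)) atTop
      (𝓝 (bridgeCov s t)) := by
  rw [tendsto_iff_norm_sub_tendsto_zero]
  refine squeeze_zero (fun _ => norm_nonneg _) (fun n => ?_)
    (tendsto_pow_atTop_nhds_zero_of_lt_one (r := (2⁻¹ : ℝ)) (by norm_num) (by norm_num))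
  rw [bridgeCov_eq_sum s t n]
  rw [sub_add_cancel_left, norm_neg, norm_mul, Real.norm_of_nonneg (by positivity)]
  refine mul_le_of_le_one_right (by positivity) ?_
  exact abs_sum_le_of_support (x := 2 ^ n * s) _ zero_le_one
    (fun k hk => bridgeCov_of_notMem hk) (fun k _ => abs_bridgeCov_le_one _ _)

/-! ### Schauder functions -/

/-- The straight line path. -/
def line : PathSpace := ⟨⟨fun s => (s : ℝ), by fun_prop⟩, rfl⟩

/-- The Schauder functions: tents of height `√2⁻¹ ^ n / 2` over the dyadic intervals of
length `2⁻¹ ^ n`. -/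
def schauder (n k : ℕ) : PathSpace :=
  ⟨⟨fun s => (√2)⁻¹ ^ n * tent (2 ^ n * (s : ℝ) - k),
    continuous_const.mul (continuous_tent.comp (by fun_prop))⟩, by
    change (√2)⁻¹ ^ n * tent (2 ^ n * 0 - k) = 0
    rw [tent_of_notMem, mul_zero]
    intro h
    have := h.1
    have : (0 : ℝ) ≤ k := k.cast_nonneg
    linarith⟩

/-- Evaluation of a path at `s`, as a continuous linear map. -/
def evalCLM (s : I) : PathSpace →L[ℝ] ℝ :=
  (ContinuousMap.evalCLM ℝ s).comp pathSubmodule.subtypeL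

lemma evalCLM_apply (s : I) (x : PathSpace) : evalCLM s x = x.1 s := rfl

lemma evalCLM_schauder (s : I) (n k : ℕ) :
    evalCLM s (schauder n k) = (√2)⁻¹ ^ n * tent (2 ^ n * (s : ℝ) - k) := rfl

/-- The index set of the Schauder basis. -/
abbrev SchauderIndex : Type := Option (Σ _ : ℕ, ℕ)

/-- The Schauder basis of the path space. -/
def schauderBasis : SchauderIndex → PathSpace
  | none => line
  | some j => schauder j.1 j.2

/-- The indices of the basis functions of level less than `n`. -/
def levelsBelow (n : ℕ) : Finset SchauderIndex :=
  Finset.insertNone ((Finset.range n).sigma fun m => Finset.range (2 ^ m))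

lemma sum_levelsBelow {E : Type*} [AddCommMonoid E] (f : SchauderIndex → E) (n : ℕ) :
    ∑ j ∈ levelsBelow n, f j =
      f none + ∑ m ∈ Finset.range n, ∑ k ∈ Finset.range (2 ^ m), f (some ⟨m, k⟩) := by
  rw [levelsBelow, Finset.sum_insertNone, Finset.sum_sigma]

/-- The line contributes `s * t`, and `min s t - s * t` is the bridge covariance on the unit square.
The factor `(√2)⁻¹ ^ m` in each Schauder function squares to the weight `2⁻¹ ^ m` of level `m`. -/
lemma tendsto_sum_schauderBasis (s t : I) :
    Tendsto (fun n => ∑ j ∈ levelsBelow n,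
      evalCLM s (schauderBasis j) * evalCLM t (schauderBasis j)) atTop (𝓝 (min (s : ℝ) t)) := by
  have h := (tendsto_sum_tent s t).const_add ((s : ℝ) * t)
  have hb : (s : ℝ) * t + bridgeCov s t = min (s : ℝ) t := by
    have hs := s.2
    have ht := t.2
    rw [bridgeCov, max_eq_right (le_min hs.1 ht.1),
      max_eq_right (sub_nonneg.2 (max_le hs.2 ht.2)), mul_sub, mul_one, min_mul_max]
    ring
  rw [hb] at h
  refine h.congr fun n => ?_
  rw [sum_levelsBelow]
  congr 1
  refine Finset.sum_congr rfl fun m _ => ?_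
  rw [Finset.mul_sum]
  refine Finset.sum_congr rfl fun k _ => ?_
  simp only [schauderBasis, evalCLM_schauder]
  have h2 : ((√2)⁻¹ ^ m) * ((√2)⁻¹ ^ m) = (2⁻¹ : ℝ) ^ m := by
    rw [← mul_pow, ← mul_inv, Real.mul_self_sqrt (by norm_num)]
  rw [← h2]
  ring

/-- At any time at most one tent of level `n` is nonzero, so the largest coefficient controls the
whole level. -/
lemma norm_sum_schauder_le (n : ℕ) (a : ℕ → ℝ) {B : ℝ} (hB : 0 ≤ B)
    (ha : ∀ k ∈ Finset.range (2 ^ n), |a k| ≤ B) :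
    ‖∑ k ∈ Finset.range (2 ^ n), a k • schauder n k‖ ≤ (√2)⁻¹ ^ n * B := by
  change ‖(∑ k ∈ Finset.range (2 ^ n), a k • schauder n k : PathSpace).1‖ ≤ _
  rw [ContinuousMap.norm_le _ (by positivity)]
  intro s
  rw [← evalCLM_apply, map_sum]
  have : ∀ k, evalCLM s (a k • schauder n k) =
      (√2)⁻¹ ^ n * (a k * tent (2 ^ n * (s : ℝ) - k)) := by
    intro k
    rw [map_smul, evalCLM_schauder, smul_eq_mul]
    ring
  simp_rw [this]
  rw [← Finset.mul_sum, norm_mul, Real.norm_of_nonneg (by positivity)]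
  refine mul_le_mul_of_nonneg_left ?_ (by positivity)
  refine abs_sum_le_of_support (x := 2 ^ n * s) _ hB
    (fun k hk => by rw [tent_of_notMem hk, mul_zero]) fun k hk => ?_
  rw [abs_mul, abs_of_nonneg (tent_nonneg _)]
  exact (mul_le_of_le_one_right (abs_nonneg _) (tent_le_one _)).trans (ha k hk)

/-! ### Convergence and law of the Lévy-Ciesielski series -/

section Levy

variable {Ω : Type*} [MeasurableSpace Ω] {P : Measure Ω}
  {ξ : SchauderIndex → Ω → ℝ}

/-- The partial sums of the Lévy-Ciesielski series with coefficients `ξ`. -/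
def levySum (ξ : SchauderIndex → Ω → ℝ) (n : ℕ) (ω : Ω) : PathSpace :=
  ∑ j ∈ levelsBelow n, ξ j ω • schauderBasis j

lemma measurable_levySum (hm : ∀ j, Measurable (ξ j)) (n : ℕ) : Measurable (levySum ξ n) :=
  Finset.measurable_fun_sum _ fun j _ => (hm j).smul_const _

/-- The coefficients of level `n` are bounded in terms of their fourth powers. -/
lemma abs_le_add_sum_pow_four (s : Finset ℕ) (a : ℕ → ℝ) {δ : ℝ} (hδ : 0 < δ) {k : ℕ}
    (hk : k ∈ s) : |a k| ≤ δ + (δ ^ 3)⁻¹ * ∑ l ∈ s, a l ^ 4 := by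
  have h1 : a k ^ 4 ≤ ∑ l ∈ s, a l ^ 4 :=
    Finset.single_le_sum (f := fun l => a l ^ 4) (fun l _ => by positivity) hk
  have h2 : |a k| ≤ δ + (δ ^ 3)⁻¹ * a k ^ 4 := by
    rcases le_total |a k| δ with h | h
    · have : 0 ≤ (δ ^ 3)⁻¹ * a k ^ 4 := by positivity
      linarith
    · have : |a k| ≤ (δ ^ 3)⁻¹ * a k ^ 4 := by
        rw [inv_mul_eq_div, le_div_iff₀ (by positivity), ← (by decide : Even 4).pow_abs,
          pow_succ' |a k| 3]
        exact mul_le_mul_of_nonneg_left (pow_le_pow_left₀ hδ.le h 3) (abs_nonneg _)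
      linarith
  refine h2.trans ?_
  gcongr

lemma integrable_pow_four (hl : ∀ j, HasLaw (ξ j) (gaussianReal 0 1) P) (j : SchauderIndex) :
    Integrable (fun ω => ξ j ω ^ 4) P := by
  have h : MemLp (ξ j) 4 P := by
    have h := IsGaussian.memLp_id (gaussianReal 0 1) 4 (by norm_num)
    rw [← (hl j).map_eq] at h
    exact h.comp_of_map (hl j).aemeasurable
  have := h.integrable_norm_pow (by norm_num)
  simpa [(by decide : Even 4).pow_abs] using this

lemma integral_pow_four (hl : ∀ j, HasLaw (ξ j) (gaussianReal 0 1) P) (j : SchauderIndex) :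
    ∫ ω, ξ j ω ^ 4 ∂P = ∫ x, x ^ 4 ∂(gaussianReal 0 1) :=
  (hl j).integral_comp (f := fun x => x ^ 4) (by fun_prop)

/-- The variable `B n` dominates the norm of level `n`, and its expectations are summable. Hence
almost surely the levels are absolutely summable in a complete space. -/
lemma ae_tendsto_levySum [IsProbabilityMeasure P] (hm : ∀ j, Measurable (ξ j))
    (hl : ∀ j, HasLaw (ξ j) (gaussianReal 0 1) P) :
    ∀ᵐ ω ∂P, ∃ x, Tendsto (fun n => levySum ξ n ω) atTop (𝓝 x) := by
  set M := ∫ x, x ^ 4 ∂(gaussianReal 0 1)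
  set w := (√2)⁻¹ with hw
  have hw0 : 0 < w := by positivity
  have hw1 : w ≤ 5 / 7 := by
    rw [hw]
    apply inv_le_of_inv_le₀ (by norm_num)
    exact Real.le_sqrt_of_sq_le (by norm_num)
  -- With `δ n = c ^ n`, the two parts of the expectation are geometric with ratios `c / √2` and `√2
  -- / c ^ 3`. Any `c` strictly between `2 ^ (1/6)` and `√2` works; second moments would instead
  -- require `√2 < c`.
  let δ : ℕ → ℝ := fun n => (13 / 10) ^ n
  have hδ : ∀ n, 0 < δ n := fun n => by positivity
  let B : ℕ → Ω → ℝ := fun n ω =>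
    w ^ n * (δ n + (δ n ^ 3)⁻¹ * ∑ k ∈ Finset.range (2 ^ n), ξ (some ⟨n, k⟩) ω ^ 4)
  have hB0 : ∀ n ω, 0 ≤ B n ω := fun n ω => by positivity
  have hBm : ∀ n, Measurable (B n) := fun n => by
    have := hm
    fun_prop
  have hBi : ∀ n, Integrable (B n) P := fun n =>
    ((integrable_const _).add ((integrable_finsetSum _ fun k _ =>
      integrable_pow_four hl _).const_mul _)).const_mul _
  have hint : ∀ n, ∫ ω, B n ω ∂P =
      (w * (13 / 10)) ^ n + M * (w * 2 * ((13 / 10) ^ 3)⁻¹) ^ n := by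
    intro n
    simp only [B]
    rw [integral_const_mul, integral_add (integrable_const _) ((integrable_finsetSum _ fun k _ =>
      integrable_pow_four hl _).const_mul _), integral_const_mul, integral_finsetSum _ fun k _ =>
      integrable_pow_four hl _]
    simp only [integral_pow_four hl, integral_const, probReal_univ, one_smul, Finset.sum_const,
      Finset.card_range, nsmul_eq_mul, δ]
    push_cast
    rw [mul_pow, mul_pow, mul_pow, inv_pow ((13 / 10) ^ 3), ← pow_mul, ← pow_mul, mul_comm n 3]
    ring
  have hsum : Summable fun n => ∫ ω, B n ω ∂P := by
    simp_rw [hint]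
    refine (summable_geometric_of_lt_one (by positivity) (by linarith)).add
      ((summable_geometric_of_lt_one (by positivity) ?_).mul_left M)
    rw [mul_inv_lt_iff₀ (by norm_num)]
    linarith
  have hfin : ∫⁻ ω, ∑' n, ENNReal.ofReal (B n ω) ∂P ≠ ⊤ := by
    rw [lintegral_tsum fun n => (hBm n).ennreal_ofReal.aemeasurable]
    have : ∀ n, ∫⁻ ω, ENNReal.ofReal (B n ω) ∂P = ENNReal.ofReal (∫ ω, B n ω ∂P) := fun n =>
      (ofReal_integral_eq_lintegral_ofReal (hBi n) (ae_of_all _ (hB0 n))).symm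
    simp_rw [this]
    exact hsum.tsum_ofReal_ne_top
  filter_upwards [ae_lt_top' (AEMeasurable.tsum fun n =>
    (hBm n).ennreal_ofReal.aemeasurable) hfin] with ω hω
  have hs : Summable fun n => B n ω := by
    have := ENNReal.summable_toReal hω.ne
    simpa [ENNReal.toReal_ofReal (hB0 _ ω)] using this
  have hs' : Summable fun n => ∑ k ∈ Finset.range (2 ^ n), ξ (some ⟨n, k⟩) ω • schauder n k := by
    refine Summable.of_norm_bounded hs fun n => ?_
    have hd := hδ n
    exact norm_sum_schauder_le n _ (by positivity) fun k hk =>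
      abs_le_add_sum_pow_four _ (fun k => ξ (some ⟨n, k⟩) ω) (hδ n) hk
  refine ⟨_, (hs'.hasSum.tendsto_sum_nat.const_add (ξ none ω • line)).congr fun n => ?_⟩
  rw [levySum, sum_levelsBelow]
  rfl

/-- The characteristic function of a linear combination of independent standard normals. -/
lemma integral_exp_sum_gaussian (hm : ∀ j, Measurable (ξ j))
    (hl : ∀ j, HasLaw (ξ j) (gaussianReal 0 1) P) (hi : iIndepFun ξ P) (s : Finset SchauderIndex)
    (a : SchauderIndex → ℝ) :
    ∫ ω, Complex.exp ((∑ j ∈ s, ξ j ω * a j : ℝ) * Complex.I) ∂P =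
      Complex.exp (-((∑ j ∈ s, a j * a j : ℝ) : ℂ) / 2) := by
  have hi' : iIndepFun (fun j ω => ξ j ω * a j) P :=
    hi.comp (fun j x => x * a j) (fun j => by fun_prop)
  have h := (hi'.restrict s).charFun_map_fun_finsetSum_eq_prod (P := P) (s := s)
    (X := fun j ω => ξ j ω * a j) (fun j _ => ((hm j).mul_const _).aemeasurable)
  have h1 := congrFun h 1
  rw [charFun_apply_real, integral_map (by have := hm; fun_prop) (by fun_prop)] at h1
  simp only [Complex.ofReal_one, one_mul] at h1
  rw [h1, Finset.prod_apply]
  have : ∀ j, charFun (P.map fun ω => ξ j ω * a j) 1 = Complex.exp (-((a j * a j : ℝ) : ℂ) / 2) := by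
    intro j
    rw [(gaussianReal_mul_const (hl j) (a j)).map_eq, charFun_gaussianReal]
    congr 1
    push_cast
    simp
    ring
  simp_rw [this]
  rw [← Complex.exp_sum]
  congr 1
  push_cast
  rw [← Finset.sum_div, Finset.sum_neg_distrib]

/-- The limit of the Lévy-Ciesielski series has the right finite dimensional distributions. -/
lemma map_proj_levy [IsProbabilityMeasure P] (hm : ∀ j, Measurable (ξ j))
    (hl : ∀ j, HasLaw (ξ j) (gaussianReal 0 1) P) (hi : iIndepFun ξ P) {X : Ω → PathSpace}
    (hX : AEMeasurable X P) (hlim : ∀ᵐ ω ∂P, Tendsto (fun n => levySum ξ n ω) atTop (𝓝 (X ω)))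
    {p : ℕ} (u : Fin p → I) : (P.map X).map (proj u) = gauss u := by
  have := Measure.isProbabilityMeasure_map (μ := P) hX
  have := Measure.isProbabilityMeasure_map (μ := P.map X) (measurable_proj u).aemeasurable
  refine Measure.ext_of_charFun (funext fun v => ?_)
  rw [gauss, charFun_multivariateGaussian (posSemidef_minCov u), charFun_apply,
    integral_map (measurable_proj u).aemeasurable (by fun_prop),
    integral_map hX (Measurable.aestronglyMeasurable (by have := measurable_proj u; fun_prop))]
  -- The inner product with `v` is a continuous linear functional of the path, so it commutes with
  -- the finite sums and passes to the limit.
  let ℓ : PathSpace →L[ℝ] ℝ := ∑ i, v i • evalCLM (u i)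
  have hℓ : ∀ x, inner ℝ (proj u x) v = ℓ x := fun x => by
    simp [ℓ, PiLp.inner_apply, proj_apply, evalCLM_apply]
  simp_rw [hℓ]
  have h1 : Tendsto (fun n => ∫ ω, Complex.exp ((ℓ (levySum ξ n ω) : ℝ) * Complex.I) ∂P) atTop
      (𝓝 (∫ ω, Complex.exp ((ℓ (X ω) : ℝ) * Complex.I) ∂P)) := by
    refine tendsto_integral_of_dominated_convergence (fun _ => 1) (fun n => ?_)
      (integrable_const _) (fun n => ae_of_all _ fun ω => ?_) ?_
    · have := measurable_levySum hm n
      exact Measurable.aestronglyMeasurable (by fun_prop)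
    · rw [Complex.norm_exp_ofReal_mul_I]
    · filter_upwards [hlim] with ω hω
      have hc : Continuous fun x => Complex.exp ((ℓ x : ℝ) * Complex.I) := by fun_prop
      exact (hc.tendsto _).comp hω
  -- The same integrals are Gaussian characteristic functions with truncated covariances, which
  -- converge to `min` by `tendsto_sum_schauderBasis`.
  refine tendsto_nhds_unique h1 ?_
  have h2 : ∀ n, ∫ ω, Complex.exp ((ℓ (levySum ξ n ω) : ℝ) * Complex.I) ∂P =
      Complex.exp (-((∑ i, ∑ j, v i * v j * ∑ l ∈ levelsBelow n,
        evalCLM (u i) (schauderBasis l) * evalCLM (u j) (schauderBasis l) : ℝ) : ℂ) / 2) := by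
    intro n
    have h3 : ∀ ω, ℓ (levySum ξ n ω) = ∑ j ∈ levelsBelow n, ξ j ω * ℓ (schauderBasis j) := by
      intro ω
      simp [levySum]
    simp_rw [h3]
    rw [integral_exp_sum_gaussian hm hl hi]
    congr 4
    simp_rw [Finset.mul_sum]
    rw [Finset.sum_congr rfl fun i _ => Finset.sum_comm, Finset.sum_comm]
    refine Finset.sum_congr rfl fun l _ => ?_
    simp only [ℓ, sum_apply, smul_apply, smul_eq_mul]
    rw [Finset.sum_mul_sum]
    exact Finset.sum_congr rfl fun i _ => Finset.sum_congr rfl fun j _ => by ring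
  simp_rw [h2]
  have h4 : v ⬝ᵥ (minCov u).mulVec v = ∑ i, ∑ j, v i * v j * min (u i : ℝ) (u j) := by
    simp only [dotProduct, Matrix.mulVec, minCov, Matrix.of_apply, Finset.mul_sum]
    exact Finset.sum_congr rfl fun i _ => Finset.sum_congr rfl fun j _ => by ring
  rw [h4, inner_zero_right, Complex.ofReal_zero, zero_mul, zero_sub, ← neg_div]
  have hc : Continuous fun x : ℝ => Complex.exp (-(x : ℂ) / 2) := by fun_prop
  exact (hc.tendsto _).comp (tendsto_finsetSum _ fun i _ => tendsto_finsetSum _ fun j _ =>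
    (tendsto_sum_schauderBasis (u i) (u j)).const_mul _)

end Levy

/-! ### Existence and conclusion -/

/-- There is a probability measure on the path space with the finite dimensional distributions of
Brownian motion. -/
lemma exists_measure_map_proj : ∃ P : Measure PathSpace, IsProbabilityMeasure P ∧
    ∀ (p : ℕ) (u : Fin p → I), P.map (proj u) = gauss u := by
  obtain ⟨Ω, _, P, ξ, hm, hl, hi, _⟩ := exists_iid SchauderIndex (gaussianReal 0 1)
  obtain ⟨X, hX⟩ := (ae_tendsto_levySum hm hl).choice
  -- The limit `X` is merely chosen pointwise; its measurability is recovered from the almost sure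
  -- convergence.
  have hXm := aemeasurable_of_tendsto_metrizable_ae'
    (fun n => (measurable_levySum hm n).aemeasurable) hX
  exact ⟨P.map X, Measure.isProbabilityMeasure_map hXm,
    fun p u => map_proj_levy hm hl hi hXm hX u⟩

end WienerConstruction

end

theorem mainTheorem2 (t : ℕ → unitInterval) (ht : DenseRange t) :
    ∃ P : Measure WienerConstruction.PathSpace,
      IsProbabilityMeasure P ∧
      (∀ A : Set WienerConstruction.PathSpace, MeasurableSet A →
        P A = WienerConstruction.mu t A) ∧
      (∀ (p : ℕ) (u : Fin p → unitInterval),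
        HasLaw (WienerConstruction.proj u)
          (multivariateGaussian 0 (Matrix.of fun j r => min (u j : ℝ) (u r : ℝ))) P) ∧
      WienerConstruction.IsBrownianMotion WienerConstruction.coordinate P ∧
      (∀ Q : Measure WienerConstruction.PathSpace,
        WienerConstruction.IsWienerMeasure Q ↔ Q = P) := by
  obtain ⟨P, hP, hlaw⟩ := WienerConstruction.exists_measure_map_proj
  refine ⟨P, hP, fun A hA => WienerConstruction.measure_eq_mu ht hlaw hA,
    fun p u => ⟨(WienerConstruction.measurable_proj u).aemeasurable, hlaw p u⟩,
    WienerConstruction.isBrownianMotion_coordinate hlaw, fun Q => ⟨fun hQ => ?_, ?_⟩⟩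
  -- Uniqueness: `Q` and `P` both coincide with `mu t` on Borel sets.
  · have := hQ.isProbabilityMeasure
    ext A hA
    rw [WienerConstruction.measure_eq_mu ht (fun _ u => hQ.map_proj u) hA,
      WienerConstruction.measure_eq_mu ht hlaw hA]
  · rintro rfl
    exact ⟨hP, WienerConstruction.isBrownianMotion_coordinate hlaw⟩
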